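/- An overpartition of a non-negative integer $m$ is a partition of $m$ in which the first occurrence of each part size may be overlined. An overpartition $k$-tuple of $n$ with odd parts is a $k$-tuple $(\pi_1,\dots,\pi_k)$ of overpartitions (each possibly empty), all of whose parts are odd, such that the parts of all the $\pi_a$ together sum to $n$. Let $\overline{OPT}_k(n)$ denote the number of these $k$-tuples. Theorem. Let $i,j\ge 1$ be integers and let $k\geq 1$ be an integer divisible neither by $2$ nor by $3$. Then for all integers $n\ge 0$, $$\overline{OPT}_{3^i\cdot 2^j\cdot k}(3n+2)\equiv 0 \pmod{3^{i+1}\cdot 2^{j+2}}$$ and $$\overline{OPT}_{3^i\cdot 2^j\cdot k}(3n+1)\equiv 0 \pmod{3^{i}\cdot 2^{j+1}}.$$ -/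

import Mathlib

/-- An overpartition of `n`: a partition of `n` together with the set of those part sizes
whose first occurrence is overlined. Each size that occurs as a part may have its first
occurrence overlined or not. -/
structure Overpartition (n : ℕ) where
  /-- the underlying partition, a multiset of positive integers with sum `n` -/
  toPartition : n.Partition
  /-- the part sizes whose first occurrence is overlined -/
  overlined : Finset ℕ
  overlined_subset : overlined ⊆ toPartition.parts.toFinset

/-- All parts of the overpartition, overlined or not, are odd. -/
def Overpartition.HasOddParts {n : ℕ} (π : Overpartition n) : Prop :=
  ∀ m ∈ π.toPartition.parts, Odd m

/-- Overpartition `k`-tuples of `n` with odd parts: `k`-tuples `(π₁, …, πₖ)` of overpartitions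
with odd parts such that all the parts together sum to `n`. The first component of `π a` is
the number of which the second component is an overpartition. -/
def OddOverpartitionTuple (k n : ℕ) : Type :=
  {π : Fin k → (Σ m : ℕ, Overpartition m) //
    (∀ a, (π a).2.HasOddParts) ∧ ∑ a, (π a).1 = n}

/-- The number of overpartition `k`-tuples of `n` with odd parts. -/
noncomputable def OPT (k n : ℕ) : ℕ :=
  Nat.card (OddOverpartitionTuple k n)

/-- There are finitely many overpartitions of `n`. -/
instance Overpartition.instFinite (n : ℕ) : Finite (Overpartition n) := by
  refine Finite.of_injective
    (β := Σ p : n.Partition, {s : Finset ℕ // s ∈ p.parts.toFinset.powerset})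
    (fun π => ⟨π.toPartition, π.overlined, Finset.mem_powerset.2 π.overlined_subset⟩) ?_
  rintro ⟨p, s, hs⟩ ⟨q, t, ht⟩ h
  simp only [Sigma.mk.injEq] at h
  obtain ⟨rfl, h⟩ := h
  simp only [heq_eq_eq, Subtype.mk.injEq] at h
  subst h
  rfl

/-- There are finitely many overpartition `k`-tuples of `n` with odd parts, so `OPT k n` is a
genuine cardinality. -/
instance OddOverpartitionTuple.instFinite (k n : ℕ) : Finite (OddOverpartitionTuple k n) := by
  have key : ∀ (π : OddOverpartitionTuple k n) (a : Fin k), (π.1 a).1 < n + 1 := fun π a =>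
    Nat.lt_succ_of_le ((Finset.single_le_sum (f := fun b => (π.1 b).1)
      (fun _ _ => Nat.zero_le _) (Finset.mem_univ a)).trans π.2.2.le)
  refine Finite.of_injective (β := Fin k → Σ m : Fin (n + 1), Overpartition m)
    (fun π a => ⟨⟨(π.1 a).1, key π a⟩, (π.1 a).2⟩) ?_
  intro π ρ h
  refine Subtype.ext (funext fun a => ?_)
  have h' := congrArg (fun x : (Σ m : Fin (n + 1), Overpartition m) =>
    (⟨(x.1 : ℕ), x.2⟩ : Σ m : ℕ, Overpartition m)) (congrFun h a)
  exact h'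

/-!
Let `F` be the generating function of overpartitions with odd parts, so that `F^K` generates
`OPT K` (`OPT_eq_coeff_pow`). It is the product of `(1 + Xᵃ) / (1 - Xᵃ)` over odd `a`, hence
`X F' / F = 2 ∑ σ(n) Xⁿ`, the sum over odd `n` (`eulerDerivation_oddOverpartitionSeries`).
Comparing coefficients in `X (F^K)' = K F^K (X F' / F)` gives the recursion

  `N OPT_K(N) = 2K ∑ σ(n) OPT_K(N - n)`, the sum over odd `n ≤ N`  (`mul_coeff_pow`).

*Powers of three.* Let `3^i ∣ K` with `i ≥ 1`. If `3 ∤ N`, the recursion shows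
`3^i ∣ OPT_K(N)`. If `N ≡ 2` modulo `3`, then every summand on the right is divisible by `3`:
either `3 ∤ N - n`, so that `3 ∣ OPT_K(N - n)`, or `n ≡ 2` modulo `3`, so that `3 ∣ σ(n)`. This
yields the additional factor `3`.

*Powers of two.* As `X F' / F` is odd, `F(X) F(-X) = 1`. Writing `F = 1 + 2G`, this turns into
`F² = 1 + 4T` with `T` congruent modulo `2` to the odd part of `G`, hence to `∑ σ(n) Xⁿ` over odd
`n`. For odd `n ≡ 2` modulo `3` the number `σ(n)` is even because `n` is not a square
(`exists_oddOverpartitionSeries_sq`). Raising `1 + 4T` to the power `2^(j-1) m` gives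
`1 + 2^(j+1) m T` modulo `2^(j+2)`, which settles both congruences modulo powers of `2`.
-/

/-! ### The generating function -/

/-- The generating function `F = ∑ OPT 1 n Xⁿ` of overpartitions with odd parts: each part size
occurring in a partition is odd and carries the weight `2`, for the choice whether its first
occurrence is overlined. -/
noncomputable def oddOverpartitionSeries : PowerSeries ℤ :=
  Nat.Partition.genFun fun a _ => if Odd a then 2 else 0

lemma card_oddOverpartition (n : ℕ) :
    (Nat.card {π : Overpartition n // π.HasOddParts} : ℤ) =
      PowerSeries.coeff n oddOverpartitionSeries := by
  let e : {π : Overpartition n // π.HasOddParts} ≃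
      Σ p : n.Partition, {s : Finset ℕ // s ⊆ p.parts.toFinset ∧ ∀ m ∈ p.parts, Odd m} :=
    { toFun := fun π => ⟨π.1.toPartition, π.1.overlined, π.1.overlined_subset, π.2⟩
      invFun := fun q => ⟨⟨q.1, q.2.1, q.2.2.1⟩, q.2.2.2⟩
      left_inv := fun _ => rfl
      right_inv := fun _ => rfl }
  have hfin (p : n.Partition) :
      Finite {s : Finset ℕ // s ⊆ p.parts.toFinset ∧ ∀ m ∈ p.parts, Odd m} :=
    Set.Finite.subset (p.parts.toFinset.powerset.finite_toSet)
      fun s hs => by simpa using hs.1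
  rw [Nat.card_congr e, Nat.card_sigma, oddOverpartitionSeries, Nat.Partition.coeff_genFun,
    Nat.cast_sum]
  refine Finset.sum_congr rfl fun p _ => ?_
  rw [Finsupp.prod, Multiset.toFinsupp_support]
  by_cases h : ∀ m ∈ p.parts, Odd m
  · rw [Finset.prod_congr rfl (g := fun _ => (2 : ℤ))
      fun m hm => if_pos (h m (Multiset.mem_toFinset.1 hm)), Finset.prod_const]
    have : Nat.card {s : Finset ℕ // s ⊆ p.parts.toFinset ∧ ∀ m ∈ p.parts, Odd m} =
        Nat.card p.parts.toFinset.powerset :=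
      Nat.card_congr (Equiv.subtypeEquivRight fun s => by
        simp only [Finset.mem_powerset, and_iff_left_iff_imp]
        exact fun _ => h)
    rw [this, Nat.card_eq_fintype_card, Fintype.card_coe, Finset.card_powerset]
    norm_num
  · have : IsEmpty {s : Finset ℕ // s ⊆ p.parts.toFinset ∧ ∀ m ∈ p.parts, Odd m} :=
      ⟨fun s => h s.2.2⟩
    rw [Nat.card_of_isEmpty, Nat.cast_zero, eq_comm]
    push Not at h
    obtain ⟨m, hm, hodd⟩ := h
    exact Finset.prod_eq_zero (Multiset.mem_toFinset.2 hm) (if_neg (by simpa using hodd))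

lemma OPT_eq_coeff_pow (K n : ℕ) :
    (OPT K n : ℤ) = PowerSeries.coeff n (oddOverpartitionSeries ^ K) := by
  let e : OddOverpartitionTuple K n ≃
      Σ s : (Finset.piAntidiag (Finset.univ : Finset (Fin K)) n),
        ∀ a, {π : Overpartition (s.1 a) // π.HasOddParts} :=
    { toFun := fun π => ⟨⟨fun a => (π.1 a).1, by simpa using π.2.2⟩,
        fun a => ⟨(π.1 a).2, π.2.1 a⟩⟩
      invFun := fun q => ⟨fun a => ⟨q.1.1 a, (q.2 a).1⟩, fun a => (q.2 a).2,
        (Finset.mem_piAntidiag.1 q.1.2).1⟩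
      left_inv := fun _ => rfl
      right_inv := fun _ => rfl }
  have hpow : oddOverpartitionSeries ^ K = ∏ _a : Fin K, oddOverpartitionSeries := by simp
  rw [OPT, Nat.card_congr e, Nat.card_sigma, hpow, PowerSeries.coeff_prod,
    Finset.sum_coe_sort (Finset.piAntidiag (Finset.univ : Finset (Fin K)) n)
      (fun s => Nat.card (∀ a, {π : Overpartition (s a) // π.HasOddParts})), Nat.cast_sum]
  refine Finset.sum_nbij' (fun s => Finsupp.equivFunOnFinite.symm s) (fun l => ⇑l)
    ?_ ?_ ?_ ?_ ?_
  · intro s hs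
    simpa using hs
  · intro l hl
    simpa using hl
  · intro s _
    rfl
  · intro l _
    simp
  · intro s _
    simp [Nat.card_pi, card_oddOverpartition]

lemma even_coeff_oddOverpartitionSeries {n : ℕ} (hn : n ≠ 0) :
    2 ∣ PowerSeries.coeff n oddOverpartitionSeries := by
  rw [oddOverpartitionSeries, Nat.Partition.coeff_genFun]
  refine Finset.dvd_sum fun p _ => ?_
  have hp : p.parts ≠ 0 := fun h => hn (by simpa [h] using p.parts_sum.symm)
  obtain ⟨m, hm⟩ := Multiset.exists_mem_of_ne_zero hp
  rw [Finsupp.prod, Multiset.toFinsupp_support]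
  refine dvd_trans ?_ (Finset.dvd_prod_of_mem _ (Multiset.mem_toFinset.2 hm))
  split_ifs <;> simp

lemma coeff_zero_oddOverpartitionSeries :
    PowerSeries.coeff 0 oddOverpartitionSeries = 1 := by
  rw [oddOverpartitionSeries, Nat.Partition.coeff_genFun]
  simp

/-! ### The logarithmic derivative -/

/-- The derivation `f ↦ X f'`, which multiplies the coefficient of `Xⁿ` by `n`. -/
noncomputable def eulerDerivation : Derivation ℤ (PowerSeries ℤ) (PowerSeries ℤ) :=
  (PowerSeries.X : PowerSeries ℤ) • PowerSeries.derivative ℤ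

lemma coeff_eulerDerivation (f : PowerSeries ℤ) (n : ℕ) :
    PowerSeries.coeff n (eulerDerivation f) = n * PowerSeries.coeff n f := by
  change PowerSeries.coeff n (PowerSeries.X * PowerSeries.derivative ℤ f) = _
  cases n with
  | zero => simp
  | succ n =>
    rw [PowerSeries.coeff_succ_X_mul, PowerSeries.coeff_derivative]
    push_cast
    ring

lemma eulerDerivation_X_pow (a : ℕ) :
    eulerDerivation (PowerSeries.X ^ a) = (a : PowerSeries ℤ) * PowerSeries.X ^ a := by
  ext n
  rw [coeff_eulerDerivation, ← map_natCast (PowerSeries.C (R := ℤ)), PowerSeries.coeff_C_mul,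
    PowerSeries.coeff_X_pow]
  split_ifs with h
  · simp [h]
  · simp

lemma Derivation.prod_eq_of_logDeriv {R A : Type*} [CommRing R] [CommRing A] [Algebra R A]
    (D : Derivation R A A) {ι : Type*} {g l : ι → A} (h : ∀ i, D (g i) = l i * g i)
    (s : Finset ι) : D (∏ i ∈ s, g i) = (∑ i ∈ s, l i) * ∏ i ∈ s, g i := by
  classical
  induction s using Finset.induction_on with
  | empty => simp
  | insert a s ha ih =>
    rw [Finset.prod_insert ha, Finset.sum_insert ha, D.leibniz, ih, h]
    simp only [smul_eq_mul]
    ring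

/-- The contribution of the odd part size `a` to the logarithmic derivative `X F' / F`, namely
`2a Xᵃ / (1 - X²ᵃ)`, the sum of `2a Xⁿ` over the odd multiples `n` of `a`. -/
noncomputable def logDerivTerm (a : ℕ) : PowerSeries ℤ :=
  PowerSeries.mk fun n => if a ∣ n ∧ Odd n then 2 * (a : ℤ) else 0

lemma logDerivTerm_mul {a : ℕ} (ha : Odd a) :
    logDerivTerm a * (1 - PowerSeries.X ^ a * PowerSeries.X ^ a) =
      2 * (a : PowerSeries ℤ) * PowerSeries.X ^ a := by
  have h2 : (2 * (a : PowerSeries ℤ)) = PowerSeries.C (2 * (a : ℤ)) := by simp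
  have h0 : 0 < a := ha.pos
  ext n
  rw [mul_sub, mul_one, ← pow_add, map_sub, PowerSeries.coeff_mul_X_pow', h2,
    PowerSeries.coeff_C_mul, PowerSeries.coeff_X_pow, logDerivTerm, PowerSeries.coeff_mk,
    PowerSeries.coeff_mk]
  by_cases hn : a + a ≤ n
  · have hd : a ∣ n - (a + a) ↔ a ∣ n := by
      rw [Nat.dvd_sub_iff_left hn (Dvd.intro_left 2 (by ring))]
    have ho : Odd (n - (a + a)) ↔ Odd n := by
      rw [Nat.odd_sub hn]
      simp
    rw [if_pos hn, if_congr (and_congr hd ho) rfl rfl, sub_self, if_neg (by omega), mul_zero]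
  · rw [if_neg hn, sub_zero]
    have : (a ∣ n ∧ Odd n) ↔ n = a := by
      constructor
      · rintro ⟨⟨c, rfl⟩, hc⟩
        have hc2 : c < 2 := by
          by_contra! h
          exact hn (by nlinarith)
        interval_cases c
        · simp at hc
        · simp
      · rintro rfl
        exact ⟨dvd_rfl, ha⟩
    simp [this]

open scoped PowerSeries.WithPiTopology in
/-- The factor of `F` belonging to an odd part size `a` is `(1 + Xᵃ) / (1 - Xᵃ)`. -/
lemma oddFactor_mul {a : ℕ} (ha : Odd a) :
    (1 + ∑' j : ℕ, (2 : ℤ) • (PowerSeries.X : PowerSeries ℤ) ^ (a * (j + 1))) *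
      (1 - PowerSeries.X ^ a) = 1 + PowerSeries.X ^ a := by
  have h0 : PowerSeries.constantCoeff ((PowerSeries.X : PowerSeries ℤ) ^ a) = 0 := by
    simp [ha.pos.ne']
  have h1 := PowerSeries.WithPiTopology.one_sub_mul_tsum_pow_of_constantCoeff_eq_zero h0
  have hs := PowerSeries.WithPiTopology.summable_pow_of_constantCoeff_eq_zero h0
  have h2 : ∑' j : ℕ, (2 : ℤ) • (PowerSeries.X : PowerSeries ℤ) ^ (a * (j + 1)) =
      (2 * PowerSeries.X ^ a) * ∑' j : ℕ, (PowerSeries.X ^ a) ^ j := by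
    rw [← hs.tsum_mul_left]
    refine tsum_congr fun j => ?_
    rw [zsmul_eq_mul, ← pow_mul, mul_assoc, ← pow_add, mul_add, mul_one, add_comm]
    norm_num
  rw [h2]
  linear_combination (2 * PowerSeries.X ^ a) * h1

lemma eulerDerivation_eq_logDerivTerm_mul {a : ℕ} (ha : Odd a) {g : PowerSeries ℤ}
    (hg : g * (1 - PowerSeries.X ^ a) = 1 + PowerSeries.X ^ a) :
    eulerDerivation g = logDerivTerm a * g := by
  have hl := logDerivTerm_mul ha
  have hd := congrArg eulerDerivation hg
  rw [Derivation.leibniz, map_sub, map_add, Derivation.map_one_eq_zero, eulerDerivation_X_pow]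
    at hd
  simp only [smul_eq_mul] at hd
  set x : PowerSeries ℤ := PowerSeries.X ^ a
  have hx : PowerSeries.constantCoeff x = 0 := by simp [x, ha.pos.ne']
  have hne : (1 - x) * (1 - x * x) ≠ 0 := by
    intro h
    simpa [hx] using congrArg PowerSeries.constantCoeff h
  refine mul_right_cancel₀ hne ?_
  linear_combination (1 - x * x) * hd - g * (1 - x) * hl + (a : PowerSeries ℤ) * x * (x - 1) * hg

/-- The series `∑ σ(n) Xⁿ` over odd `n`, which is half of `X F' / F`. -/
noncomputable def oddSigmaSeries : PowerSeries ℤ :=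
  PowerSeries.mk fun n => if Odd n then ((∑ d ∈ n.divisors, d : ℕ) : ℤ) else 0

open scoped PowerSeries.WithPiTopology in
lemma hasSum_logDerivTerm :
    HasSum (fun i : ℕ => if Odd (i + 1) then logDerivTerm (i + 1) else 0)
      (2 * oddSigmaSeries) := by
  rw [PowerSeries.WithPiTopology.hasSum_iff_hasSum_coeff]
  intro n
  have h2 : (2 : PowerSeries ℤ) = PowerSeries.C 2 := by simp
  have key : PowerSeries.coeff n (2 * oddSigmaSeries) = ∑ i ∈ Finset.range n,
      PowerSeries.coeff n (if Odd (i + 1) then logDerivTerm (i + 1) else 0) := by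
    rw [h2, PowerSeries.coeff_C_mul, oddSigmaSeries, PowerSeries.coeff_mk]
    by_cases hn : Odd n
    · rw [if_pos hn, Nat.divisors, Finset.sum_filter, Nat.cast_sum, Finset.mul_sum,
        Finset.sum_Ico_eq_sum_range]
      refine Finset.sum_congr (by simp) fun i _ => ?_
      by_cases hi : i + 1 ∣ n
      · rw [if_pos (hn.of_dvd_nat hi), logDerivTerm, PowerSeries.coeff_mk, if_pos (And.intro hi hn),
          if_pos (by rwa [add_comm]), add_comm]
      · rw [if_neg (by rwa [add_comm] : ¬ 1 + i ∣ n)]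
        split_ifs <;> simp [logDerivTerm, hi]
    · rw [if_neg hn, mul_zero, eq_comm]
      refine Finset.sum_eq_zero fun i _ => ?_
      split_ifs <;> simp [logDerivTerm, hn]
  rw [key]
  refine hasSum_sum_of_ne_finset_zero fun i hi => ?_
  have hni : n ≤ i := by simpa using hi
  split_ifs
  · rw [logDerivTerm, PowerSeries.coeff_mk, if_neg]
    rintro ⟨hd, ho⟩
    have := Nat.le_of_dvd ho.pos hd
    omega
  · simp

open scoped PowerSeries.WithPiTopology in
lemma continuous_eulerDerivation : Continuous eulerDerivation := by
  rw [continuous_iff_continuousAt]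
  intro f
  rw [ContinuousAt, PowerSeries.WithPiTopology.tendsto_iff_coeff_tendsto]
  intro n
  simp_rw [coeff_eulerDerivation]
  exact ((PowerSeries.WithPiTopology.continuous_coeff ℤ n).tendsto f).const_mul _

open scoped PowerSeries.WithPiTopology in
/-- The logarithmic derivative `X F' / F` of `F = ∏ (1 + Xᵃ) / (1 - Xᵃ)`, with `a` odd: the sum of
those of the factors, passed to the limit over finite products. -/
theorem eulerDerivation_oddOverpartitionSeries :
    eulerDerivation oddOverpartitionSeries = 2 * oddSigmaSeries * oddOverpartitionSeries := by
  have hprod := Nat.Partition.hasProd_genFun (R := ℤ) fun a _ => if Odd a then 2 else 0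
  set g : ℕ → PowerSeries ℤ := fun i => 1 + ∑' j : ℕ,
    (if Odd (i + 1) then (2 : ℤ) else 0) • PowerSeries.X ^ ((i + 1) * (j + 1)) with hg
  have hterm (i : ℕ) : eulerDerivation (g i) =
      (if Odd (i + 1) then logDerivTerm (i + 1) else 0) * g i := by
    by_cases h : Odd (i + 1)
    · rw [if_pos h]
      refine eulerDerivation_eq_logDerivTerm_mul h ?_
      simpa only [hg, if_pos h] using oddFactor_mul h
    · simp [hg, h]
  have h1 := (continuous_eulerDerivation.tendsto _).comp hprod
  have h2 := Filter.Tendsto.mul hasSum_logDerivTerm hprod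
  refine tendsto_nhds_unique h1 (h2.congr fun s => ?_)
  exact (eulerDerivation.prod_eq_of_logDeriv hterm s).symm

/-! ### Divisor sums -/

/-- Pairing `d` with `n / d`, whose product is `2` modulo `3`. -/
lemma three_dvd_sum_divisors {n : ℕ} (hn : n % 3 = 2) : 3 ∣ ∑ d ∈ n.divisors, d := by
  have h2 : 3 ∣ ∑ d ∈ n.divisors, (d + n / d) := by
    refine Finset.dvd_sum fun d hd => ?_
    have hdn : d * (n / d) = n := Nat.mul_div_cancel' (Nat.dvd_of_mem_divisors hd)
    have hmod : (d % 3) * ((n / d) % 3) % 3 = 2 := by rw [← Nat.mul_mod, hdn, hn]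
    have h1 : d % 3 < 3 := Nat.mod_lt _ (by norm_num)
    have h3 : (n / d) % 3 < 3 := Nat.mod_lt _ (by norm_num)
    generalize n / d = e at *
    rw [Nat.dvd_iff_mod_eq_zero, Nat.add_mod]
    generalize d % 3 = a at *
    generalize e % 3 = b at *
    interval_cases a <;> interval_cases b <;> simp_all
  rw [Finset.sum_add_distrib, Nat.sum_div_divisors n fun d => d, ← two_mul] at h2
  exact Nat.Coprime.dvd_of_dvd_mul_left (by norm_num) h2

/-- The sum has an even number of terms, as `n ≡ 2` modulo `3` is not a square, and all of them
are odd. -/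
lemma two_dvd_sum_divisors {n : ℕ} (hn : n % 3 = 2) (ho : Odd n) :
    2 ∣ ∑ d ∈ n.divisors, d := by
  rw [← ZMod.natCast_eq_zero_iff, Nat.cast_sum]
  have hodd {d : ℕ} (hd : d ∣ n) : (d : ZMod 2) = 1 :=
    ZMod.natCast_eq_one_iff_odd.2 (ho.of_dvd_nat hd)
  refine Finset.sum_involution (fun d _ => n / d) ?_ ?_ ?_ ?_
  · intro d hd
    have hd' := Nat.dvd_of_mem_divisors hd
    rw [hodd hd', hodd (Nat.div_dvd_of_dvd hd')]
    decide
  · intro d hd _ h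
    have hdn : d * (n / d) = n := Nat.mul_div_cancel' (Nat.dvd_of_mem_divisors hd)
    rw [h] at hdn
    have hmod : (d % 3) * (d % 3) % 3 = 2 := by rw [← Nat.mul_mod, hdn, hn]
    have h1 : d % 3 < 3 := Nat.mod_lt _ (by norm_num)
    generalize d % 3 = a at *
    interval_cases a <;> simp_all
  · intro d hd
    exact Nat.mem_divisors.2
      ⟨Nat.div_dvd_of_dvd (Nat.dvd_of_mem_divisors hd), (Nat.mem_divisors.1 hd).2⟩
  · intro d hd
    exact Nat.div_div_self (Nat.dvd_of_mem_divisors hd) (Nat.mem_divisors.1 hd).2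

/-! ### Powers of three -/

/-- The coefficients of `X (F^K)' = K F^K (X F' / F)`. -/
lemma mul_coeff_pow (K n : ℕ) :
    (n : ℤ) * PowerSeries.coeff n (oddOverpartitionSeries ^ K) =
      2 * K * ∑ p ∈ Finset.HasAntidiagonal.antidiagonal n, PowerSeries.coeff p.1 oddSigmaSeries *
        PowerSeries.coeff p.2 (oddOverpartitionSeries ^ K) := by
  have h : eulerDerivation (oddOverpartitionSeries ^ K) =
      PowerSeries.C (2 * (K : ℤ)) * (oddSigmaSeries * oddOverpartitionSeries ^ K) := by
    rw [Derivation.leibniz_pow, eulerDerivation_oddOverpartitionSeries]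
    cases K with
    | zero => simp
    | succ m =>
      simp only [Nat.add_sub_cancel, nsmul_eq_mul, smul_eq_mul]
      simp only [map_mul, map_natCast, map_ofNat]
      ring
  rw [← coeff_eulerDerivation, h, PowerSeries.coeff_C_mul, PowerSeries.coeff_mul]

lemma isCoprime_three_pow {n : ℕ} (hn : ¬ 3 ∣ n) (i : ℕ) : IsCoprime ((3 : ℤ) ^ i) (n : ℤ) := by
  refine IsCoprime.pow_left ?_
  exact_mod_cast Nat.isCoprime_iff_coprime.2 ((Nat.Prime.coprime_iff_not_dvd Nat.prime_three).2 hn)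

lemma three_pow_dvd_coeff_pow {i K n : ℕ} (hK : 3 ^ i ∣ K) (hn : ¬ 3 ∣ n) :
    (3 : ℤ) ^ i ∣ PowerSeries.coeff n (oddOverpartitionSeries ^ K) := by
  refine (isCoprime_three_pow hn i).dvd_of_dvd_mul_left ?_
  rw [mul_coeff_pow]
  have hK' : (3 : ℤ) ^ i ∣ K := by exact_mod_cast hK
  exact (hK'.mul_left 2).mul_right _

/-- In the recursion for the coefficients, a term with second index prime to `3` is divisible
by `3` by the previous lemma, and otherwise the first index is `2` modulo `3`. -/
lemma three_pow_succ_dvd_coeff_pow {i K n : ℕ} (hi : 1 ≤ i) (hK : 3 ^ i ∣ K) (hn : n % 3 = 2) :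
    (3 : ℤ) ^ (i + 1) ∣ PowerSeries.coeff n (oddOverpartitionSeries ^ K) := by
  refine (isCoprime_three_pow (n := n) (by omega) (i + 1)).dvd_of_dvd_mul_left ?_
  rw [mul_coeff_pow, pow_succ]
  have hK' : (3 : ℤ) ^ i ∣ K := by exact_mod_cast hK
  have hK3 : 3 ^ 1 ∣ K := (pow_dvd_pow 3 hi).trans hK
  refine mul_dvd_mul (hK'.mul_left 2) (Finset.dvd_sum fun p hp => ?_)
  rw [Finset.HasAntidiagonal.mem_antidiagonal] at hp
  by_cases h : 3 ∣ p.2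
  · refine Dvd.dvd.mul_right ?_ _
    rw [oddSigmaSeries, PowerSeries.coeff_mk]
    split_ifs
    · exact_mod_cast three_dvd_sum_divisors (by omega : p.1 % 3 = 2)
    · exact dvd_zero _
  · exact Dvd.dvd.mul_left (by simpa using three_pow_dvd_coeff_pow hK3 h) _

/-! ### Powers of two -/

/-- `F(X) F(-X) = 1`, since the logarithmic derivative of `F` has only odd powers of `X`. -/
lemma oddOverpartitionSeries_mul_rescale :
    oddOverpartitionSeries * PowerSeries.rescale (-1 : ℤ) oddOverpartitionSeries = 1 := by
  have hresc (f : PowerSeries ℤ) : eulerDerivation (PowerSeries.rescale (-1 : ℤ) f) =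
      PowerSeries.rescale (-1 : ℤ) (eulerDerivation f) := by
    ext n
    simp only [coeff_eulerDerivation, PowerSeries.coeff_rescale]
    ring
  have hodd : PowerSeries.rescale (-1 : ℤ) oddSigmaSeries = -oddSigmaSeries := by
    ext n
    rw [PowerSeries.coeff_rescale, map_neg, oddSigmaSeries, PowerSeries.coeff_mk]
    split_ifs with h
    · rw [h.neg_one_pow, neg_one_mul]
    · simp
  have hd : eulerDerivation (oddOverpartitionSeries *
      PowerSeries.rescale (-1 : ℤ) oddOverpartitionSeries) = 0 := by
    rw [Derivation.leibniz, hresc, eulerDerivation_oddOverpartitionSeries]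
    simp only [map_mul, map_ofNat, hodd, smul_eq_mul]
    ring
  ext n
  by_cases hn : n = 0
  · subst hn
    simp [PowerSeries.coeff_mul, coeff_zero_oddOverpartitionSeries]
  · have h := congrArg (PowerSeries.coeff n) hd
    rw [coeff_eulerDerivation, map_zero] at h
    rw [PowerSeries.coeff_one, if_neg hn]
    exact (mul_eq_zero.1 h).resolve_left (by exact_mod_cast hn)

/-- With `F = 1 + 2G`, the relation `F(X) F(-X) = 1` gives `F² = 1 + 4T`, where `T` is congruent
modulo `2` to the odd part of `G`; by the logarithmic derivative of `F`, the latter is congruent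
to `∑ σ(n) Xⁿ` over odd `n`. -/
lemma exists_oddOverpartitionSeries_sq : ∃ T : PowerSeries ℤ,
    oddOverpartitionSeries ^ 2 = 1 + 4 * T ∧ ∀ n, n % 3 = 2 → 2 ∣ PowerSeries.coeff n T := by
  obtain ⟨G, hG⟩ : ∃ G : PowerSeries ℤ, oddOverpartitionSeries = 1 + PowerSeries.C 2 * G := by
    refine ⟨PowerSeries.mk fun n =>
      if n = 0 then 0 else PowerSeries.coeff n oddOverpartitionSeries / 2, ?_⟩
    ext n
    rw [map_add, PowerSeries.coeff_one, PowerSeries.coeff_C_mul, PowerSeries.coeff_mk]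
    split_ifs with hn
    · simp [hn, coeff_zero_oddOverpartitionSeries]
    · rw [zero_add, Int.mul_ediv_cancel' (even_coeff_oddOverpartitionSeries hn)]
  have h2 : (PowerSeries.C 2 : PowerSeries ℤ) = 2 := by simp
  set O : PowerSeries ℤ := PowerSeries.mk fun n => if Odd n then PowerSeries.coeff n G else 0
    with hO
  have hsub : G - PowerSeries.rescale (-1 : ℤ) G = 2 * O := by
    ext n
    rw [← h2, map_sub, PowerSeries.coeff_rescale, PowerSeries.coeff_C_mul, hO,
      PowerSeries.coeff_mk]
    split_ifs with h
    · rw [h.neg_one_pow]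
      ring
    · rw [(Nat.not_odd_iff_even.1 h).neg_one_pow]
      ring
  have hone := oddOverpartitionSeries_mul_rescale
  rw [hG] at hone ⊢
  simp only [map_add, map_one, map_mul, h2, map_ofNat] at hone ⊢
  refine ⟨O + 2 * (O * G), by linear_combination hone + (2 + 4 * G) * hsub, fun n hn => ?_⟩
  rw [map_add, ← h2, PowerSeries.coeff_C_mul]
  refine dvd_add ?_ (dvd_mul_right _ _)
  rw [hO, PowerSeries.coeff_mk]
  split_ifs with ho
  swap
  · exact dvd_zero _
  have hd := eulerDerivation_oddOverpartitionSeries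
  rw [hG, h2, two_mul, map_add, map_add, Derivation.map_one_eq_zero, zero_add] at hd
  have hd' : eulerDerivation G = oddSigmaSeries + PowerSeries.C 2 * (oddSigmaSeries * G) := by
    have h4 : (2 : PowerSeries ℤ) ≠ 0 := by
      rw [← h2, Ne, map_eq_zero_iff _ PowerSeries.C_injective]
      norm_num
    refine mul_left_cancel₀ h4 ?_
    rw [h2]
    linear_combination hd
  have hc := congrArg (PowerSeries.coeff n) hd'
  rw [coeff_eulerDerivation, map_add, PowerSeries.coeff_C_mul, oddSigmaSeries,
    PowerSeries.coeff_mk, if_pos ho] at hc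
  have hdvd : (2 : ℤ) ∣ n * PowerSeries.coeff n G := by
    rw [hc]
    exact dvd_add (by exact_mod_cast two_dvd_sum_divisors hn ho) (dvd_mul_right _ _)
  refine (Int.prime_two.dvd_mul.1 hdvd).resolve_left fun h => ?_
  have : 2 ∣ n := by exact_mod_cast h
  exact ho.not_two_dvd_nat this

lemma exists_one_add_four_mul_pow_two_pow {R : Type*} [CommRing R] (T : R) (a : ℕ) :
    ∃ U, (1 + 4 * T) ^ 2 ^ a = 1 + 2 ^ (a + 2) * (T + 2 * U) := by
  induction a with
  | zero => exact ⟨0, by ring⟩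
  | succ a ih =>
    obtain ⟨U, hU⟩ := ih
    refine ⟨U + 2 ^ a * (T + 2 * U) ^ 2, ?_⟩
    rw [pow_succ 2 a, pow_mul, hU]
    ring

lemma exists_one_add_two_pow_mul_pow {R : Type*} [CommRing R] (W : R) (a m : ℕ) :
    ∃ U, (1 + 2 ^ (a + 2) * W) ^ m = 1 + 2 ^ (a + 2) * (m * W + 2 * U) := by
  induction m with
  | zero => exact ⟨0, by simp⟩
  | succ m ih =>
    obtain ⟨U, hU⟩ := ih
    refine ⟨U + 2 ^ (a + 1) * W * (m * W + 2 * U), ?_⟩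
    rw [pow_succ, hU]
    push_cast
    ring

lemma two_pow_dvd_coeff_pow {j : ℕ} (hj : 1 ≤ j) (m n : ℕ) (hn : n ≠ 0) :
    (2 : ℤ) ^ (j + 1) ∣ PowerSeries.coeff n (oddOverpartitionSeries ^ (2 ^ j * m)) ∧
      (n % 3 = 2 →
        (2 : ℤ) ^ (j + 2) ∣ PowerSeries.coeff n (oddOverpartitionSeries ^ (2 ^ j * m))) := by
  obtain ⟨a, rfl⟩ := Nat.exists_eq_add_of_le' hj
  obtain ⟨T, hT, hdvd⟩ := exists_oddOverpartitionSeries_sq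
  obtain ⟨U, hU⟩ := exists_one_add_four_mul_pow_two_pow T a
  obtain ⟨V, hV⟩ := exists_one_add_two_pow_mul_pow (T + 2 * U) a m
  have hpow : oddOverpartitionSeries ^ (2 ^ (a + 1) * m) =
      1 + PowerSeries.C (2 ^ (a + 2)) *
        (PowerSeries.C (m : ℤ) * T + PowerSeries.C 2 * (PowerSeries.C (m : ℤ) * U + V)) := by
    rw [pow_mul, pow_succ' 2 a, pow_mul, hT, hU, hV]
    simp only [map_pow, map_ofNat, map_natCast]
    ring
  rw [hpow, map_add, PowerSeries.coeff_one, if_neg hn, zero_add, PowerSeries.coeff_C_mul]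
  refine ⟨dvd_mul_right _ _, fun h => ?_⟩
  rw [show a + 1 + 2 = a + 2 + 1 by ring, pow_succ, map_add, PowerSeries.coeff_C_mul,
    PowerSeries.coeff_C_mul]
  exact mul_dvd_mul_left _ (dvd_add ((hdvd n h).mul_left _) (dvd_mul_right _ _))

/-! ### The congruences -/

theorem theorem1p6 (i j k : ℕ) (hi : 1 ≤ i) (hj : 1 ≤ j) (hk2 : ¬ 2 ∣ k) (hk3 : ¬ 3 ∣ k) :
    (∀ n : ℕ, OPT (3 ^ i * 2 ^ j * k) (3 * n + 2) ≡ 0 [MOD 3 ^ (i + 1) * 2 ^ (j + 2)]) ∧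
    (∀ n : ℕ, OPT (3 ^ i * 2 ^ j * k) (3 * n + 1) ≡ 0 [MOD 3 ^ i * 2 ^ (j + 1)]) := by
  have h3 : 3 ^ i ∣ 3 ^ i * 2 ^ j * k := ⟨2 ^ j * k, mul_assoc _ _ _⟩
  have h2 : 3 ^ i * 2 ^ j * k = 2 ^ j * (3 ^ i * k) := by ring
  have hcop (a b : ℕ) : Nat.Coprime (3 ^ a) (2 ^ b) := Nat.Coprime.pow _ _ (by norm_num)
  refine ⟨fun n => ?_, fun n => ?_⟩ <;> rw [Nat.modEq_zero_iff_dvd] <;>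
    refine (hcop _ _).mul_dvd_of_dvd_of_dvd ?_ ?_ <;> zify <;> rw [OPT_eq_coeff_pow]
  · exact three_pow_succ_dvd_coeff_pow hi h3 (by omega)
  · rw [h2]
    exact (two_pow_dvd_coeff_pow hj _ _ (by omega)).2 (by omega)
  · exact three_pow_dvd_coeff_pow h3 (by omega)
  · rw [h2]
    exact (two_pow_dvd_coeff_pow hj _ _ (by omega)).1
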